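/- For a group $G$, let $\omega(G)$ denote the number of automorphism orbits of $G$, that is, the number (possibly infinite) of orbits of the natural action of $\mathrm{Aut}(G)$ on $G$. A group is an FC-group if each of its conjugacy classes is finite, and a $2$-group if the order of each of its elements is a (finite) power of $2$. Let $G$ be an infinite non-abelian FC-group. Assume that $G$ is a $2$-group. Then $\omega(G) \geqslant 4$. -/

import Mathlib

/-- An FC-group: every conjugacy class is finite. -/
def IsFCGroup (G : Type*) [Group G] : Prop :=
  ∀ g : G, (conjugatesOf g).Finite

/-- The number of automorphism orbits of `G`, as a cardinal: the number of orbits of the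
natural action of `Aut(G)` on `G`. -/
noncomputable def autOrbitCard (G : Type*) [Group G] : Cardinal :=
  Cardinal.mk (MulAction.orbitRel.Quotient (MulAut G) G)

open scoped commutatorElement

/-! With at most three orbits, these must be {1}, Z \ {1} and G \ Z, where Z is the center:
Dietzmann's lemma makes Z nontrivial. It also gives G/Z a nontrivial center, so transitivity on G \
Z forces class two, and all [x, G] with x ∉ Z have equal size, leaving only finitely many
commutators. Each element of Z is a commutator, so Z is finite. Squares lie in Z and involutions are
central. Among infinitely many commuting elements, infinitely many share a square; their quotients
square to 1, so lie in the finite Z, a contradiction. -/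

namespace IsFCGroup

variable {G : Type*} [Group G]

/-- The centralizer of a finite subset of an FC-group has finite index. -/
theorem finiteIndex_centralizer (h : IsFCGroup G) {s : Set G} (hs : s.Finite) :
    (Subgroup.centralizer s).FiniteIndex := by
  have key (g : G) : (Subgroup.centralizer {g}).FiniteIndex := by
    have : Finite (conjugatesOf g) := h g
    let f : G ⧸ Subgroup.centralizer {g} → conjugatesOf g := Quotient.lift
      (fun x => ⟨x * g * x⁻¹, isConj_iff.mpr ⟨x, rfl⟩⟩) (by
        intro a b hab
        have hc := Subgroup.mem_centralizer_singleton_iff.mp (QuotientGroup.leftRel_apply.mp hab)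
        apply Subtype.ext
        change a * g * a⁻¹ = b * g * b⁻¹
        calc a * g * a⁻¹ = a * (g * (a⁻¹ * b)) * b⁻¹ := by group
          _ = a * ((a⁻¹ * b) * g) * b⁻¹ := by rw [hc]
          _ = b * g * b⁻¹ := by group)
    have hf : Function.Injective f := by
      intro a b
      refine Quotient.inductionOn₂ a b fun a b hab => ?_
      have hab : a * g * a⁻¹ = b * g * b⁻¹ := congrArg Subtype.val hab
      refine Quotient.sound (QuotientGroup.leftRel_apply.mpr
        (Subgroup.mem_centralizer_singleton_iff.mpr ?_))
      calc a⁻¹ * b * g = a⁻¹ * (b * g * b⁻¹) * b := by group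
        _ = a⁻¹ * (a * g * a⁻¹) * b := by rw [hab]
        _ = g * (a⁻¹ * b) := by group
    have := Finite.of_injective f hf
    exact Subgroup.finiteIndex_of_finite_quotient
  have := hs.to_subtype
  have hi : (⨅ g : s, Subgroup.centralizer {(g : G)}).FiniteIndex :=
    Subgroup.finiteIndex_iInf fun g => key g
  refine Subgroup.finiteIndex_of_le (H := ⨅ g : s, Subgroup.centralizer {(g : G)}) ?_
  intro x hx
  rw [Subgroup.mem_iInf] at hx
  exact Subgroup.mem_centralizer_iff.mpr fun g hg =>
    (Subgroup.mem_centralizer_singleton_iff.mp (hx ⟨g, hg⟩)).symm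

theorem of_surjective {H : Type*} [Group H] (h : IsFCGroup G) (f : G →* H)
    (hf : Function.Surjective f) : IsFCGroup H := by
  intro y
  obtain ⟨x, rfl⟩ := hf y
  refine ((h x).image f).subset ?_
  intro z hz
  obtain ⟨c, rfl⟩ := isConj_iff.mp hz
  obtain ⟨c, rfl⟩ := hf c
  exact ⟨c * x * c⁻¹, isConj_iff.mpr ⟨c, rfl⟩, by simp⟩

/-- **Dietzmann's lemma**: the normal closure of an element of a torsion FC-group is finite. -/
theorem finite_normalClosure_singleton (h : IsFCGroup G) (ht : ∀ g : G, IsOfFinOrder g) (x : G) :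
    Finite (Subgroup.normalClosure {x}) := by
  have hs : (Group.conjugatesOfSet {x}).Finite := by
    simpa [Group.conjugatesOfSet] using h x
  let N := Subgroup.normalClosure {x}
  let K := Subgroup.centralizer (Group.conjugatesOfSet {x})
  have hK : K.FiniteIndex := h.finiteIndex_centralizer hs
  have hNFG : Group.FG N :=
    (Group.fg_iff_subgroup_fg _).mpr ((Subgroup.fg_iff _).mpr ⟨_, rfl, hs⟩)
  have hKN : K ≤ Subgroup.centralizer N := by
    rw [Subgroup.le_centralizer_iff]
    exact (Subgroup.closure_le _).mpr fun y hy => Subgroup.mem_centralizer_iff.mpr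
      fun k hk => ((Subgroup.mem_centralizer_iff.mp hk) y hy).symm
  -- K ∩ N is central in N and of finite index, so it is abelian, finitely generated and torsion,
  -- hence finite.
  have hfi : (K.subgroupOf N).FiniteIndex := inferInstance
  have hFG : Group.FG (K.subgroupOf N) := inferInstance
  let _ : CommGroup (K.subgroupOf N) :=
    { (inferInstance : Group (K.subgroupOf N)) with
      mul_comm := fun a b => Subtype.ext (Subtype.ext
        ((Subgroup.mem_centralizer_iff.mp (hKN b.2)) _ a.1.2)) }
  have hfin : Finite (K.subgroupOf N) := by
    exact CommGroup.finite_of_fg_isMulTorsion _ ((IsMulTorsion.subgroup ht N).subgroup _)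
  have := Subgroup.finite_quotient_of_finiteIndex (H := K.subgroupOf N)
  exact Finite.of_subgroup_quotient (K.subgroupOf N)

/-- A nontrivial FC-group which is a `p`-group has a nontrivial center. -/
theorem exists_ne_one_mem_center {p : ℕ} [Fact p.Prime] [Nontrivial G] (h : IsFCGroup G)
    (hp : IsPGroup p G) : ∃ z ∈ Subgroup.center G, z ≠ 1 := by
  obtain ⟨x, hx⟩ := exists_ne (1 : G)
  have := h.finite_normalClosure_singleton (hp.isOfFinOrder (Fact.out : p.Prime).ne_zero) x
  let N := Subgroup.normalClosure {x}
  let _ : MulAction G N := MulAction.compHom N (MulAut.conjNormal (H := N))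
  have hsm (g : G) (n : N) : ((g • n : N) : G) = g * n * g⁻¹ := MulAut.conjNormal_apply g n
  have : Nontrivial N := ⟨⟨x, Subgroup.subset_normalClosure rfl⟩, 1, fun he =>
    hx (congrArg Subtype.val he)⟩
  have hd : p ∣ Nat.card N :=
    (hp.to_subgroup N).card_eq_or_dvd.resolve_left Finite.one_lt_card.ne'
  -- The fixed points of conjugation on N are its central elements.
  obtain ⟨b, hb, hb1⟩ := hp.exists_fixed_point_of_prime_dvd_card_of_fixed_point N hd (a := 1)
    (fun g => Subtype.ext (by rw [hsm]; simp))
  refine ⟨b, Subgroup.mem_center_iff.mpr fun g => ?_, fun he => hb1 (Subtype.ext he.symm)⟩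
  have := hsm g b
  rw [hb g] at this
  exact (eq_mul_inv_iff_mul_eq.mp this).symm

/-- An infinite FC-group has infinitely many pairwise commuting elements. -/
theorem exists_injective_commute [Infinite G] (h : IsFCGroup G) :
    ∃ f : ℕ → G, Function.Injective f ∧ ∀ m n, Commute (f m) (f n) := by
  have hstep (s : Finset G) (_ : ∀ x ∈ s, True) :
      ∃ y : G, True ∧ ∀ x ∈ s, Commute x y ∧ x ≠ y := by
    have := h.finiteIndex_centralizer s.finite_toSet
    have hinf : Infinite (Subgroup.centralizer (s : Set G)) := by
      by_contra hf
      rw [not_infinite_iff_finite] at hf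
      have := Subgroup.finite_quotient_of_finiteIndex (H := Subgroup.centralizer (s : Set G))
      have := Finite.of_subgroup_quotient (Subgroup.centralizer (s : Set G))
      exact not_finite G
    obtain ⟨y, hy, hys⟩ := (Set.infinite_coe_iff.mp hinf).exists_notMem_finset s
    exact ⟨y, trivial, fun x hx => ⟨Subgroup.mem_centralizer_iff.mp hy x hx,
      fun he => hys (he ▸ hx)⟩⟩
  obtain ⟨f, -, hf⟩ := exists_seq_of_forall_finset_exists (fun _ : G => True)
    (fun x y => Commute x y ∧ x ≠ y) hstep
  refine ⟨f, fun m n hmn => ?_, fun m n => ?_⟩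
  · rcases lt_trichotomy m n with hlt | rfl | hlt
    · exact absurd hmn (hf m n hlt).2
    · rfl
    · exact absurd hmn.symm (hf n m hlt).2
  · rcases lt_trichotomy m n with hlt | rfl | hlt
    · exact (hf m n hlt).1
    · exact Commute.refl _
    · exact (hf n m hlt).1.symm

/-- In an FC-group of nilpotency class at most two in which all the sets of commutators with a
fixed noncentral element have the same cardinality, there are finitely many commutators. -/
theorem finite_commutatorSet (h : IsFCGroup G) (hc : ∀ a b : G, ⁅a, b⁆ ∈ Subgroup.center G)
    (hcard : ∀ a b : G, a ∉ Subgroup.center G → b ∉ Subgroup.center G →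
      (Set.range fun g : G => ⁅a, g⁆).ncard = (Set.range fun g : G => ⁅b, g⁆).ncard) :
    (commutatorSet G).Finite := by
  have hmul (a b g : G) : ⁅a * b, g⁆ = ⁅a, g⁆ * ⁅b, g⁆ := by
    have hb := Subgroup.mem_center_iff.mp (hc b g)
    calc ⁅a * b, g⁆ = (a * ⁅b, g⁆) * (g * a⁻¹ * g⁻¹) := by simp only [commutatorElement_def]; group
      _ = ⁅b, g⁆ * ⁅a, g⁆ := by rw [hb a]; simp only [commutatorElement_def]; group
      _ = ⁅a, g⁆ * ⁅b, g⁆ := (hb _).symm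
  have hfin (x : G) : (Set.range fun g : G => ⁅x, g⁆).Finite := by
    refine ((h x⁻¹).image (x * ·)).subset ?_
    rintro _ ⟨g, rfl⟩
    exact ⟨g * x⁻¹ * g⁻¹, isConj_iff.mpr ⟨g, rfl⟩, by simp only [commutatorElement_def]; group⟩
  have hcent (x : G) (hx : x ∈ Subgroup.center G) (g : G) : ⁅x, g⁆ = 1 :=
    commutatorElement_eq_one_iff_mul_comm.mpr (Subgroup.mem_center_iff.mp hx g).symm
  by_cases hab : ∀ x, x ∈ Subgroup.center G
  · refine (Set.finite_singleton 1).subset ?_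
    rintro _ ⟨a, b, rfl⟩
    exact hcent a (hab a) b
  push Not at hab
  obtain ⟨x, hx⟩ := hab
  obtain ⟨t, ht, htx⟩ : ∃ t : Set G, t.Finite ∧ ∀ g, ∃ u ∈ t, ⁅x, g⁆ = ⁅x, u⁆ := by
    have := (hfin x).to_subtype
    choose s hs using fun y : Set.range (fun g : G => ⁅x, g⁆) => y.2
    exact ⟨Set.range s, Set.finite_range s, fun g =>
      ⟨s ⟨_, g, rfl⟩, ⟨_, rfl⟩, (hs ⟨_, g, rfl⟩).symm⟩⟩
  -- For c ∈ C, ⁅x * c, u⁆ = ⁅x, u⁆ on representatives u ∈ t, so [x, G] ⊆ [xc, G], with equality by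
  -- cardinality. Hence ⁅c, g⁆ = ⁅x, g⁆⁻¹ * ⁅x * c, g⁆ stays in a finite set.
  let C := Subgroup.centralizer t
  have hC : C.FiniteIndex := h.finiteIndex_centralizer ht
  have hsub (c : G) (hcC : c ∈ C) :
      (Set.range fun g : G => ⁅x, g⁆) = Set.range fun g : G => ⁅x * c, g⁆ := by
    have hle : (Set.range fun g : G => ⁅x, g⁆) ⊆ Set.range fun g : G => ⁅x * c, g⁆ := by
      rintro _ ⟨g, rfl⟩
      obtain ⟨u, hu, hgu⟩ := htx g
      refine ⟨u, ?_⟩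
      have : ⁅c, u⁆ = 1 := commutatorElement_eq_one_iff_mul_comm.mpr
        (Subgroup.mem_centralizer_iff.mp hcC u hu).symm
      simp only [hmul, this, hgu, mul_one]
    refine Set.eq_of_subset_of_ncard_le hle (hcard _ _ ?_ hx).le (hfin _)
    intro hxc
    refine hx (Subgroup.mem_center_iff.mpr fun g => ?_)
    obtain ⟨k, hk⟩ := hle ⟨g, rfl⟩
    have : ⁅x, g⁆ = 1 := by rw [← hcent _ hxc k]; exact hk.symm
    exact (commutatorElement_eq_one_iff_mul_comm.mp this).symm
  let F : Set G := Set.image2 (fun a b => a⁻¹ * b) (Set.range fun g : G => ⁅x, g⁆)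
    (Set.range fun g : G => ⁅x, g⁆)
  have hF (c : G) (hcC : c ∈ C) (g : G) : ⁅c, g⁆ ∈ F := by
    refine ⟨⁅x, g⁆, ⟨g, rfl⟩, ⁅x * c, g⁆, ?_, ?_⟩
    · rw [hsub c hcC]; exact ⟨g, rfl⟩
    · simp only [hmul]; group
  have : Finite (G ⧸ C) := Subgroup.finite_quotient_of_finiteIndex
  refine (Set.finite_iUnion fun q : G ⧸ C => (hfin q.out).image2 (· * ·)
    (((hfin x).image2 (fun a b => a⁻¹ * b) (hfin x) : F.Finite))).subset ?_
  rintro _ ⟨a, b, rfl⟩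
  obtain ⟨c, hc'⟩ := QuotientGroup.mk_out_eq_mul C a
  refine Set.mem_iUnion.mpr ⟨(a : G ⧸ C), _, ⟨b, rfl⟩, ⁅(c : G)⁻¹, b⁆, hF _ (C.inv_mem c.2) b, ?_⟩
  simp only
  rw [← hmul, hc', mul_inv_cancel_right]

end IsFCGroup

/-- If there are fewer than four automorphism orbits, two of any four elements are conjugate under
the automorphism group. -/
theorem exists_mulAut_apply_eq_of_autOrbitCard_lt {G : Type*} [Group G] (h : autOrbitCard G < 4)
    (f : Fin 4 → G) : ∃ i j, i < j ∧ ∃ φ : MulAut G, φ (f i) = f j := by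
  by_contra hne
  push Not at hne
  refine h.not_ge ?_
  have hinj : Function.Injective
      (fun i => (Quotient.mk _ (f i) : MulAction.orbitRel.Quotient (MulAut G) G)) := by
    intro i j hij
    obtain ⟨φ, hφ⟩ := Quotient.exact hij
    have hφ : φ (f j) = f i := hφ
    rcases lt_trichotomy i j with hlt | rfl | hlt
    · exact absurd (by rw [← hφ]; exact φ.symm_apply_apply _) (hne i j hlt φ⁻¹)
    · rfl
    · exact absurd hφ (hne j i hlt φ)
  simpa [autOrbitCard] using Cardinal.mk_le_of_injective (hinj.comp ULift.down_injective)

theorem mulAut_apply_mem_center_iff {G : Type*} [Group G] (φ : MulAut G) (g : G) :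
    φ g ∈ Subgroup.center G ↔ g ∈ Subgroup.center G := by
  have key (φ : MulAut G) (g : G) (hg : g ∈ Subgroup.center G) : φ g ∈ Subgroup.center G := by
    refine Subgroup.mem_center_iff.mpr fun k => ?_
    obtain ⟨k, rfl⟩ := φ.surjective k
    rw [← map_mul, ← map_mul, Subgroup.mem_center_iff.mp hg k]
  exact ⟨fun h => by simpa using key φ⁻¹ _ h, key φ g⟩

theorem mainTheorem9 (G : Type*) [Group G] [Infinite G] (hFC : IsFCGroup G)
    (hnonab : ¬ ∀ a b : G, a * b = b * a) (h2 : IsPGroup 2 G) :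
    4 ≤ autOrbitCard G := by
  by_contra hlt
  rw [not_le] at hlt
  obtain ⟨a, haZ, ha1⟩ := hFC.exists_ne_one_mem_center h2
  obtain ⟨b, hbZ⟩ : ∃ b, b ∉ Subgroup.center G := by
    by_contra hall
    push Not at hall
    exact hnonab fun x y => Subgroup.mem_center_iff.mp (hall y) x
  have horb (g : G) (hg1 : g ≠ 1) :
      (∃ φ : MulAut G, φ a = g) ∨ ∃ φ : MulAut G, φ b = g := by
    have hb1 : b ≠ 1 := fun he => hbZ (he ▸ Subgroup.one_mem _)
    have h1 (φ : MulAut G) (x : G) (hx : x ≠ 1) : φ 1 ≠ x := by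
      rw [map_one]; exact hx.symm
    obtain ⟨i, j, hij, φ, hφ⟩ := exists_mulAut_apply_eq_of_autOrbitCard_lt hlt ![1, a, b, g]
    fin_cases i <;> fin_cases j <;> simp at hij hφ
    · exact absurd hφ.symm ha1
    · exact absurd hφ.symm hb1
    · exact absurd hφ.symm hg1
    · exact absurd ((mulAut_apply_mem_center_iff φ a).mpr haZ) (hφ ▸ hbZ)
    · exact Or.inl ⟨φ, hφ⟩
    · exact Or.inr ⟨φ, hφ⟩
  have hin (z w : G) (hz : z ∈ Subgroup.center G) (hz1 : z ≠ 1) (hw : w ∈ Subgroup.center G)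
      (hw1 : w ≠ 1) : ∃ φ : MulAut G, φ z = w := by
    have key (g : G) (hg : g ∈ Subgroup.center G) (hg1 : g ≠ 1) : ∃ φ : MulAut G, φ a = g :=
      (horb g hg1).resolve_right fun ⟨φ, hφ⟩ =>
        hbZ ((mulAut_apply_mem_center_iff φ b).mp (hφ ▸ hg))
    obtain ⟨φ, rfl⟩ := key z hz hz1
    obtain ⟨ψ, rfl⟩ := key w hw hw1
    exact ⟨ψ * φ⁻¹, by simp⟩
  have hout (x y : G) (hx : x ∉ Subgroup.center G) (hy : y ∉ Subgroup.center G) :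
      ∃ φ : MulAut G, φ x = y := by
    have key (g : G) (hg : g ∉ Subgroup.center G) : ∃ φ : MulAut G, φ b = g :=
      (horb g fun he => hg (he ▸ Subgroup.one_mem _)).resolve_left fun ⟨φ, hφ⟩ =>
        hg (hφ ▸ (mulAut_apply_mem_center_iff φ a).mpr haZ)
    obtain ⟨φ, rfl⟩ := key x hx
    obtain ⟨ψ, rfl⟩ := key y hy
    exact ⟨ψ * φ⁻¹, by simp⟩
  have hcomm (x y : G) : ⁅x, y⁆ ∈ Subgroup.center G := by
    by_cases hx : x ∈ Subgroup.center G
    · rw [commutatorElement_eq_one_iff_mul_comm.mpr (Subgroup.mem_center_iff.mp hx y).symm]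
      exact Subgroup.one_mem _
    have : Nontrivial (G ⧸ Subgroup.center G) :=
      ⟨(b : G ⧸ Subgroup.center G), 1, fun he => hbZ ((QuotientGroup.eq_one_iff b).mp he)⟩
    obtain ⟨q, hq, hq1⟩ :=
      (hFC.of_surjective (QuotientGroup.mk' (Subgroup.center G))
        (QuotientGroup.mk'_surjective _)).exists_ne_one_mem_center
          (h2.to_quotient (Subgroup.center G))
    obtain ⟨u, rfl⟩ := QuotientGroup.mk'_surjective _ q
    have huZ : u ∉ Subgroup.center G := fun hu => hq1 ((QuotientGroup.eq_one_iff u).mpr hu)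
    obtain ⟨φ, rfl⟩ := hout u x huZ hx
    obtain ⟨y, rfl⟩ := φ.surjective y
    rw [← map_commutatorElement, mulAut_apply_mem_center_iff]
    refine (QuotientGroup.eq_one_iff _).mp ?_
    change QuotientGroup.mk' (Subgroup.center G) ⁅u, y⁆ = 1
    rw [map_commutatorElement]
    exact commutatorElement_eq_one_iff_mul_comm.mpr (Subgroup.mem_center_iff.mp hq _).symm
  have hsqZ (x : G) : x ^ 2 ∈ Subgroup.center G := by
    by_cases hx : x ∈ Subgroup.center G
    · exact Subgroup.pow_mem _ hx 2
    -- The last noncentral term among the iterated squares of b has a central square; automorphisms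
    -- carry this to x.
    have hex : ∃ k, b ^ 2 ^ k ∈ Subgroup.center G := by
      obtain ⟨k, hk⟩ := h2 b
      exact ⟨k, hk ▸ Subgroup.one_mem _⟩
    classical
    obtain ⟨k, hk, hmin⟩ := Nat.findX hex
    obtain _ | k := k
    · exact absurd (by simpa using hk) hbZ
    obtain ⟨φ, rfl⟩ := hout (b ^ 2 ^ k) x (hmin k k.lt_succ_self) hx
    rw [← map_pow, mulAut_apply_mem_center_iff, ← pow_mul, ← pow_succ]
    exact hk
  have hsq (x : G) (hx : x ^ 2 = 1) : x ∈ Subgroup.center G := by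
    by_contra hxZ
    have hall (y : G) (hy : y ∉ Subgroup.center G) : y ^ 2 = 1 := by
      obtain ⟨φ, rfl⟩ := hout x y hxZ hy
      rw [← map_pow, hx, map_one]
    have hex (y : G) : y ^ 2 = 1 := by
      by_cases hy : y ∈ Subgroup.center G
      -- For central y, x * y is noncentral, so 1 = (x * y)² = y².
      · have hxy : x * y ∉ Subgroup.center G := fun hm =>
          hxZ ((Subgroup.mul_mem_cancel_right _ hy).mp hm)
        have := hall _ hxy
        rwa [(show Commute x y from Subgroup.mem_center_iff.mp hy x).mul_pow, hx, one_mul] at this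
      · exact hall y hy
    exact hnonab fun y z => Commute.of_orderOf_dvd_two (fun g => orderOf_dvd_of_pow_eq_one (hex g)) y z
  have hZ : (Subgroup.center G : Set G) ⊆ commutatorSet G := by
    intro z hz
    by_cases hz1 : z = 1
    · exact ⟨1, 1, by simp [hz1]⟩
    push Not at hnonab
    obtain ⟨x, y, hxy⟩ := hnonab
    obtain ⟨φ, rfl⟩ := hin ⁅x, y⁆ z (hcomm x y)
      (fun he => hxy (commutatorElement_eq_one_iff_mul_comm.mp he)) hz hz1
    exact ⟨φ x, φ y, (map_commutatorElement φ x y).symm⟩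
  have hfin : (commutatorSet G).Finite := by
    refine hFC.finite_commutatorSet hcomm fun x y hx hy => ?_
    obtain ⟨φ, rfl⟩ := hout x y hx hy
    have : (Set.range fun g : G => ⁅φ x, g⁆) = φ '' Set.range fun g : G => ⁅x, g⁆ := by
      rw [← Set.range_comp, ← φ.surjective.range_comp]
      simp [Function.comp_def, map_commutatorElement]
    rw [this, Set.ncard_image_of_injective _ φ.injective]
  have hZfin : (Subgroup.center G : Set G).Finite := hfin.subset hZ
  have : Finite (Subgroup.center G) := hZfin
  obtain ⟨f, hf, hfc⟩ := hFC.exists_injective_commute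
  obtain ⟨z, hz⟩ := Finite.exists_infinite_fiber
    fun n => (⟨f n ^ 2, hsqZ _⟩ : Subgroup.center G)
  obtain ⟨m, hm⟩ := (Set.infinite_coe_iff.mp hz).nonempty
  refine Set.infinite_coe_iff.mp hz ((hZfin.preimage (f := fun n => f n * (f m)⁻¹)
    fun i _ j _ hij => hf (mul_right_cancel hij)).subset fun n hn => hsq _ ?_)
  have hnm : f n ^ 2 = f m ^ 2 := congrArg Subtype.val ((Set.mem_preimage.mp hn).trans
    (Set.mem_preimage.mp hm).symm)
  rw [(hfc n m).inv_right.mul_pow, hnm, inv_pow, mul_inv_cancel]
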